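/- Let $X$ and $Y$ be compact Hausdorff spaces and let $f\colon X\to Y$ be a continuous surjection. Let $2^X$ be the set of all non-empty closed subsets of $X$ with the Vietoris topology, that is, the topology with base the sets $\{K\in 2^X : K\subseteq U_1\cup\dots\cup U_n,\ K\cap U_i\neq\emptyset\ (1\le i\le n)\}$, for $n\ge 1$ and $U_1,\dots,U_n$ non-empty open subsets of $X$. Let $2^{X,f}=\{A\in 2^X : A\subseteq f^{-1}(y)\text{ for some }y\in Y\}$ with the subspace topology, and let $f'\colon 2^{X,f}\to Y$ be the map that sends $A$ to the unique $y\in Y$ with $f[A]=\{y\}$ (the quasifactor of $f$). Let $\mathfrak{M}(X)$ be the set of all regular Borel probability measures on $X$ with the weak-$*$ topology, that is, the coarsest topology for which $\mu\mapsto\int_X\varphi\,d\mu$ is continuous for every continuous $\varphi\colon X\to\mathbb{R}$; define $\mathfrak{M}(Y)$ likewise, and let $f_*\colon\mathfrak{M}(X)\to\mathfrak{M}(Y)$, $f_*(\mu)=\mu\circ f^{-1}$. Then the following are equivalent: 1. $f$ is an open map; 2. $f'\colon 2^{X,f}\to Y$ is an open map; 3. $f_*\colon\mathfrak{M}(X)\to\mathfrak{M}(Y)$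 is an open map. -/

import Mathlib

open MeasureTheory TopologicalSpace

namespace OpenMaps

/-- The hyperspace `2^X` of a compact Hausdorff space `X`: the non-empty closed (equivalently,
non-empty compact) subsets of `X` with the Vietoris topology, which Mathlib puts on
`NonemptyCompacts X`. -/
abbrev Hyperspace (X : Type*) [TopologicalSpace X] : Type _ := NonemptyCompacts X

section Hyper

variable {X Y : Type*} [TopologicalSpace X] [TopologicalSpace Y]

/-- The induced map `2^f : 2^X → 2^Y`, `K ↦ f[K]`. -/
def hyperMap (f : C(X, Y)) : Hyperspace X → Hyperspace Y :=
  NonemptyCompacts.map f f.continuous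

/-- The quasifactor representation `2^{X,f} = {A ∈ 2^X | ∃ y ∈ Y, A ⊆ f⁻¹(y)}`; as a type it has
the subspace topology from `2^X`. -/
def quasifactorRep (f : C(X, Y)) : Set (Hyperspace X) :=
  {A | ∃ y : Y, (A : Set X) ⊆ f ⁻¹' {y}}

/-- `2^f` maps `2^{X,f}` into the singletons of `Y`, each value determining its point. -/
theorem existsUnique_hyperMap_eq_singleton (f : C(X, Y)) (A : quasifactorRep f) :
    ∃! y : Y, (hyperMap f A : Set Y) = {y} := by
  obtain ⟨A, y, hy⟩ := A
  refine ⟨y, ?_, fun z hz => ?_⟩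
  · obtain ⟨a, ha⟩ := A.nonempty
    ext z
    simp only [hyperMap, NonemptyCompacts.coe_map, Set.mem_image, Set.mem_singleton_iff]
    constructor
    · rintro ⟨b, hb, rfl⟩
      exact hy hb
    · rintro rfl
      exact ⟨a, ha, hy ha⟩
  · obtain ⟨a, ha⟩ := A.nonempty
    have h1 : f a ∈ (hyperMap f A : Set Y) := Set.mem_image_of_mem f ha
    have h2 : f a = z := by
      have h3 : f a ∈ ({z} : Set Y) := hz ▸ h1
      exact h3
    exact h2.symm.trans (hy ha)

/-- The quasifactor `f' = 2^f|_{2^{X,f}} : 2^{X,f} → Y`, where `Y` is identified with the set of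
its singletons in `2^Y`: `f' A` is the point `y` with `2^f(A) = {y}`. -/
noncomputable def quasifactor (f : C(X, Y)) (A : quasifactorRep f) : Y :=
  (existsUnique_hyperMap_eq_singleton f A).choose

theorem coe_hyperMap_eq_singleton_quasifactor (f : C(X, Y)) (A : quasifactorRep f) :
    (hyperMap f A : Set Y) = {quasifactor f A} :=
  (existsUnique_hyperMap_eq_singleton f A).choose_spec.1

end Hyper

section Meas

/-- `𝔐(X)`: the regular Borel probability measures on `X`. -/
structure RegularProbability (X : Type*) [TopologicalSpace X] [MeasurableSpace X] where
  measure : Measure X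
  isProbability : IsProbabilityMeasure measure
  regular : measure.Regular

/-- The weak-* topology on `𝔐(X)`: the coarsest one making `μ ↦ ∫ φ dμ` continuous for every
continuous `φ : X → ℝ` (`X` is compact here). -/
noncomputable instance RegularProbability.instTopologicalSpace (X : Type*) [TopologicalSpace X]
    [MeasurableSpace X] : TopologicalSpace (RegularProbability X) :=
  TopologicalSpace.induced
    (fun (μ : RegularProbability X) (φ : C(X, ℝ)) => ∫ x, φ x ∂μ.measure) inferInstance

variable {X Y : Type*} [TopologicalSpace X] [CompactSpace X] [T2Space X] [MeasurableSpace X]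
  [BorelSpace X] [TopologicalSpace Y] [CompactSpace Y] [T2Space Y] [MeasurableSpace Y]
  [BorelSpace Y]

/-- The induced map `f_* : 𝔐(X) → 𝔐(Y)`, `μ ↦ μ ∘ f⁻¹`. -/
noncomputable def pushforward (f : C(X, Y)) (μ : RegularProbability X) : RegularProbability Y where
  measure := μ.measure.map f
  isProbability :=
    have := μ.isProbability
    Measure.isProbabilityMeasure_map f.continuous.measurable.aemeasurable
  regular := by
    have := μ.isProbability
    have := μ.regular
    have : (μ.measure.map f).InnerRegularCompactLTTop :=
      Measure.InnerRegularCompactLTTop.map_of_continuous f.continuous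
    infer_instance

end Meas

end OpenMaps

open Filter Topology

set_option linter.unusedSectionVars false

namespace OpenMaps

/-! ### Openness of the quasifactor -/

section Hyper

variable {X Y : Type*} [TopologicalSpace X] [TopologicalSpace Y]

/-! Singletons embed `X` in `2^{X,f}` and Dirac measures embed it in `𝔐(X)`; openness of `f` is
recovered through them. If `f` is open, finite subsets of nearby fibres show that `f'` is open.

The hard part is that openness of `f` passes to `f_*`. For open `f` the fibrewise maximum `fiberSup
f g` is continuous, so `p_ν(g) = ∫ fiberSup f g dν` is sublinear in `g` and jointly continuous in
`(ν, g)`. A linear functional dominated by `p_ν` is integration against a lift of `ν`. By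
Hahn–Banach, `ν` has a lift that is `ε`-close to `μ` on finitely many functions unless some
combination `g`, with coefficients `c`, has `∫ g dμ > p_ν(g) + ε‖c‖`. At `ν = f_* μ` none does,
since `∫ g dμ ≤ p_ν(g)`; compactness of the unit sphere of coefficients carries this to all `ν` near
`f_* μ`. -/

theorem quasifactor_eq_of_mem (f : C(X, Y)) (A : quasifactorRep f) {a : X}
    (ha : a ∈ (A : Hyperspace X)) : quasifactor f A = f a := by
  have h : f a ∈ (hyperMap f A : Set Y) := Set.mem_image_of_mem f ha
  rw [coe_hyperMap_eq_singleton_quasifactor] at h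
  exact (Set.mem_singleton_iff.1 h).symm

theorem image_quasifactor_subsets (f : C(X, Y)) (U : Set X) :
    quasifactor f '' {A | ((A : Hyperspace X) : Set X) ⊆ U} = f '' U := by
  ext y
  constructor
  · rintro ⟨A, hA, rfl⟩
    obtain ⟨a, ha⟩ := (A : Hyperspace X).nonempty
    exact ⟨a, hA ha, (quasifactor_eq_of_mem f A ha).symm⟩
  · rintro ⟨x, hx, rfl⟩
    refine ⟨⟨{x}, f x, by simp⟩, by simpa using hx, ?_⟩
    exact quasifactor_eq_of_mem f _ (a := x) (by simp)

theorem isOpenMap_of_quasifactor (f : C(X, Y)) (h : IsOpenMap (quasifactor f)) :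
    IsOpenMap f := by
  intro U hU
  rw [← image_quasifactor_subsets]
  exact h _ ((NonemptyCompacts.isOpen_subsets_of_isOpen hU).preimage continuous_subtype_val)

theorem isOpenMap_quasifactor (f : C(X, Y)) (h : IsOpenMap f) :
    IsOpenMap (quasifactor f) := by
  rintro _ ⟨W, hW, rfl⟩
  rw [isOpen_iff_mem_nhds]
  rintro _ ⟨A, hA, rfl⟩
  obtain ⟨_, ⟨u, ⟨hufin, hune, huo⟩, rfl⟩, ⟨_, hAu⟩, huW⟩ :=
    NonemptyCompacts.isTopologicalBasis.exists_subset_of_mem_open hA hW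
  have hV : (⋂ U ∈ u, f '' U) ∈ 𝓝 (quasifactor f A) := by
    refine (hufin.isOpen_biInter fun U hU => h U (huo U hU)).mem_nhds ?_
    refine Set.mem_iInter₂.2 fun U hU => ?_
    obtain ⟨a, ha, haU⟩ := hAu U hU
    exact ⟨a, haU, (quasifactor_eq_of_mem f A ha).symm⟩
  -- One point of the fibre over `y` from each `U ∈ u` gives a finite set in the basic
  -- neighbourhood.
  refine mem_of_superset hV fun y hy => ?_
  have : Nonempty X := (A : Hyperspace X).nonempty.to_subtype.map Subtype.val
  choose! x hxU hxy using fun U hU => Set.mem_iInter₂.1 hy U hU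
  have hne : (x '' u).Nonempty := hune.image x
  let B : Hyperspace X := ⟨⟨x '' u, (hufin.image x).isCompact⟩, hne⟩
  have hB : (B : Set X) ⊆ f ⁻¹' {y} := by
    rintro _ ⟨U, hU, rfl⟩
    exact hxy U hU
  refine ⟨⟨B, y, hB⟩, huW ⟨?_, fun U hU => ⟨x U, ⟨U, hU, rfl⟩, hxU U hU⟩⟩, ?_⟩
  · rintro _ ⟨U, hU, rfl⟩
    exact ⟨U, hU, hxU U hU⟩
  · obtain ⟨b, hb⟩ := B.nonempty
    exact (quasifactor_eq_of_mem f _ hb).trans (hB hb)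

end Hyper

/-! ### Fibrewise maxima -/

section FiberSup

variable {X Y : Type*} [TopologicalSpace X] [CompactSpace X] [TopologicalSpace Y] [T2Space Y]

/-- The maximum of `g` over the fibre of `f` above a point. -/
noncomputable def fiberSup (f : C(X, Y)) (g : C(X, ℝ)) (y : Y) : ℝ :=
  sSup (g '' (f ⁻¹' {y}))

theorem isCompact_fiber (f : C(X, Y)) (y : Y) : IsCompact (f ⁻¹' {y}) :=
  (isClosed_singleton.preimage f.continuous).isCompact

theorem le_fiberSup (f : C(X, Y)) (g : C(X, ℝ)) (x : X) : g x ≤ fiberSup f g (f x) :=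
  le_csSup ((isCompact_fiber f _).image g.continuous).bddAbove ⟨x, rfl, rfl⟩

theorem exists_eq_fiberSup (f : C(X, Y)) (hf : Function.Surjective f) (g : C(X, ℝ)) (y : Y) :
    ∃ x, f x = y ∧ g x = fiberSup f g y := by
  have hne : (f ⁻¹' {y}).Nonempty := hf y
  obtain ⟨x, hx, hg⟩ := ((isCompact_fiber f y).image g.continuous).sSup_mem (hne.image g)
  exact ⟨x, hx, hg⟩

theorem fiberSup_le_iff (f : C(X, Y)) (hf : Function.Surjective f) (g : C(X, ℝ)) (y : Y) (a : ℝ) :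
    fiberSup f g y ≤ a ↔ ∀ x, f x = y → g x ≤ a := by
  constructor
  · rintro h x rfl
    exact (le_fiberSup f g x).trans h
  · intro h
    obtain ⟨x, hx, hg⟩ := exists_eq_fiberSup f hf g y
    exact hg ▸ h x hx

/-- Since maxima are attained, the sets `{> a}` and `{≥ a}` are the `f`-images of those of `g`: the
former is open as `f` is open, the latter closed as `f` is a closed map. -/
theorem continuous_fiberSup (f : C(X, Y)) (hf : Function.Surjective f) (ho : IsOpenMap f)
    (g : C(X, ℝ)) : Continuous (fiberSup f g) := by
  refine OrderTopology.continuous_iff.2 fun a => ⟨?_, ?_⟩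
  · convert ho _ ((isOpen_Ioi (a := a)).preimage g.continuous) using 1
    ext y
    constructor
    · intro hy
      obtain ⟨x, hx, hg⟩ := exists_eq_fiberSup f hf g y
      exact ⟨x, by simpa [hg] using hy, hx⟩
    · rintro ⟨x, hx, rfl⟩
      exact lt_of_lt_of_le hx (le_fiberSup f g x)
  · have hc : IsClosed (f '' (g ⁻¹' Set.Ici a)) :=
      f.continuous.isClosedMap _ (isClosed_Ici.preimage g.continuous)
    convert hc.isOpen_compl using 1
    ext y
    constructor
    · rintro hy ⟨x, hx, rfl⟩
      exact absurd (lt_of_le_of_lt (le_fiberSup f g x) hy) (not_lt.2 hx)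
    · intro hy
      obtain ⟨x, hx, hg⟩ := exists_eq_fiberSup f hf g y
      rw [Set.mem_preimage, Set.mem_Iio, ← hg]
      by_contra hcon
      exact hy ⟨x, not_lt.1 hcon, hx⟩

theorem fiberSup_add_le (f : C(X, Y)) (hf : Function.Surjective f) (g h : C(X, ℝ)) (y : Y) :
    fiberSup f (g + h) y ≤ fiberSup f g y + fiberSup f h y := by
  rw [fiberSup_le_iff f hf]
  rintro x rfl
  exact add_le_add (le_fiberSup f g x) (le_fiberSup f h x)

theorem fiberSup_smul (f : C(X, Y)) (g : C(X, ℝ)) {c : ℝ} (hc : 0 ≤ c) (y : Y) :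
    fiberSup f (c • g) y = c * fiberSup f g y := by
  rw [fiberSup, fiberSup, ← smul_eq_mul, ← Real.sSup_smul_of_nonneg hc, ← Set.image_smul,
    Set.image_image]
  rfl

theorem fiberSup_comp (f : C(X, Y)) (hf : Function.Surjective f) (h : C(Y, ℝ)) (y : Y) :
    fiberSup f (h.comp f) y = h y := by
  obtain ⟨x, rfl, hg⟩ := exists_eq_fiberSup f hf (h.comp f) y
  exact hg.symm

theorem fiberSup_le_add_norm (f : C(X, Y)) (hf : Function.Surjective f) (g h : C(X, ℝ)) (y : Y) :
    fiberSup f g y ≤ fiberSup f h y + ‖g - h‖ := by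
  rw [fiberSup_le_iff f hf]
  rintro x rfl
  have h1 := (le_abs_self _).trans ((g - h).norm_coe_le_norm x)
  have h2 := le_fiberSup f h x
  simp only [ContinuousMap.sub_apply] at h1
  linarith

end FiberSup

/-! ### Openness of the pushforward -/

section Meas

namespace RegularProbability

theorem continuous_integral {X : Type*} [TopologicalSpace X] [MeasurableSpace X] (φ : C(X, ℝ)) :
    Continuous fun μ : RegularProbability X => ∫ x, φ x ∂μ.measure :=
  (continuous_apply φ : Continuous fun p : C(X, ℝ) → ℝ => p φ).comp
    (continuous_induced_dom
      (f := fun (μ : RegularProbability X) (φ : C(X, ℝ)) => ∫ x, φ x ∂μ.measure))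

theorem exists_finset_of_mem_nhds {X : Type*} [TopologicalSpace X] [MeasurableSpace X]
    {μ : RegularProbability X} {s : Set (RegularProbability X)} (hs : s ∈ 𝓝 μ) :
    ∃ (I : Finset C(X, ℝ)) (ε : ℝ), 0 < ε ∧ ∀ ν : RegularProbability X,
      (∀ φ ∈ I, |∫ x, φ x ∂ν.measure - ∫ x, φ x ∂μ.measure| ≤ ε) → ν ∈ s := by
  rw [nhds_induced, mem_comap] at hs
  obtain ⟨t, ht, hts⟩ := hs
  rw [nhds_pi, Filter.mem_pi] at ht
  obtain ⟨I, hI, v, hv, hvt⟩ := ht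
  have hδ : ∀ φ, ∃ δ > 0, Metric.closedBall (∫ x, φ x ∂μ.measure) δ ⊆ v φ := fun φ =>
    Metric.nhds_basis_closedBall.mem_iff.1 (hv φ)
  choose δ hδ0 hδv using hδ
  obtain ⟨ε, hε, hεI⟩ : ∃ ε > 0, ∀ φ ∈ hI.toFinset, ε ≤ δ φ := by
    rcases hI.toFinset.eq_empty_or_nonempty with h | h
    · exact ⟨1, one_pos, by simp [h]⟩
    · exact ⟨hI.toFinset.inf' h δ, (Finset.lt_inf'_iff h).2 fun φ _ => hδ0 φ,
        fun φ hφ => Finset.inf'_le δ hφ⟩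
  refine ⟨hI.toFinset, ε, hε, fun ν hν => hts (hvt fun φ hφ => hδv φ ?_)⟩
  have hφ' := hI.mem_toFinset.2 hφ
  exact (hν φ hφ').trans (hεI φ hφ')

variable {X Y : Type*} [TopologicalSpace X] [CompactSpace X] [T2Space X] [MeasurableSpace X]
  [BorelSpace X] [TopologicalSpace Y] [CompactSpace Y] [T2Space Y] [MeasurableSpace Y]
  [BorelSpace Y]

theorem integrable (μ : RegularProbability X) (g : C(X, ℝ)) : Integrable g μ.measure := by
  have := μ.isProbability
  exact g.continuous.integrable_of_hasCompactSupport (HasCompactSupport.of_compactSpace _)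

theorem ext_of_integral_eq {μ ν : RegularProbability X}
    (h : ∀ φ : C(X, ℝ), ∫ x, φ x ∂μ.measure = ∫ x, φ x ∂ν.measure) : μ = ν := by
  obtain ⟨μ, hμ, hμr⟩ := μ
  obtain ⟨ν, hν, hνr⟩ := ν
  congr
  exact Measure.ext_of_integral_eq_on_compactlySupported fun φ => h φ.toContinuousMap

/-- A positive normalized linear functional on `C(X, ℝ)` is the integral of a regular
probability measure. -/
theorem exists_integral_eq (L : C(X, ℝ) →ₗ[ℝ] ℝ) (hL : ∀ g, 0 ≤ g → 0 ≤ L g) (hL1 : L 1 = 1) :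
    ∃ μ : RegularProbability X, ∀ φ : C(X, ℝ), ∫ x, φ x ∂μ.measure = L φ := by
  let Λ : CompactlySupportedContinuousMap X ℝ →ₚ[ℝ] ℝ :=
    PositiveLinearMap.mk₀
      { toFun := fun g => L g.toContinuousMap
        map_add' := fun g h => L.map_add g.toContinuousMap h.toContinuousMap
        map_smul' := fun c g => L.map_smul c g.toContinuousMap }
      fun g hg => hL g.toContinuousMap hg
  have hΛ : ∀ φ : C(X, ℝ), ∫ x, φ x ∂(RealRMK.rieszMeasure Λ) = L φ := fun φ =>
    RealRMK.integral_rieszMeasure Λ (CompactlySupportedContinuousMap.continuousMapEquiv φ)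
  have h1 := hΛ 1
  rw [hL1] at h1
  refine ⟨⟨RealRMK.rieszMeasure Λ, ⟨?_⟩, inferInstance⟩, hΛ⟩
  simpa [Measure.real, ENNReal.toReal_eq_one_iff] using h1

/-- The Dirac measure at a point. -/
noncomputable def dirac (x : X) : RegularProbability X where
  measure := Measure.dirac x
  isProbability := inferInstance
  regular := by
    have : (Measure.dirac x).InnerRegularCompactLTTop := by
      refine ⟨fun s hs r hr => ?_⟩
      have hx : x ∈ s := by
        by_contra hx
        simp [Measure.dirac_apply' x hs.1, hx] at hr
      refine ⟨{x}, Set.singleton_subset_iff.2 hx, isCompact_singleton, ?_⟩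
      simpa [Measure.dirac_apply' x hs.1, hx] using hr
    infer_instance

theorem continuous_dirac : Continuous (dirac : X → RegularProbability X) := by
  refine continuous_induced_rng.2 (continuous_pi fun φ => ?_)
  simpa [dirac, Function.comp_def] using φ.continuous

theorem pushforward_dirac (f : C(X, Y)) (x : X) : pushforward f (dirac x) = dirac (f x) := by
  simp only [pushforward, dirac, Measure.map_dirac' f.continuous.measurable]

theorem integral_pushforward (f : C(X, Y)) (μ : RegularProbability X) (h : C(Y, ℝ)) :
    ∫ y, h y ∂(pushforward f μ).measure = ∫ x, h (f x) ∂μ.measure :=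
  integral_map f.continuous.measurable.aemeasurable h.continuous.aestronglyMeasurable

/-- A lift of the Dirac measure at `y` lives on the fibre over `y`. If it gives positive integral to
a function vanishing off `U`, that fibre meets `U`. -/
theorem isOpenMap_of_pushforward (f : C(X, Y)) (h : IsOpenMap (pushforward f)) :
    IsOpenMap f := by
  intro U hU
  rw [isOpen_iff_mem_nhds]
  rintro _ ⟨x, hx, rfl⟩
  obtain ⟨φ, hφ0, hφ1, hφ⟩ := exists_continuous_zero_one_of_isClosed hU.isClosed_compl
    (isClosed_singleton (x := x)) (Set.disjoint_singleton_right.2 fun h => h hx)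
  have hW : IsOpen {μ : RegularProbability X | 0 < ∫ x, φ x ∂μ.measure} :=
    isOpen_lt continuous_const (continuous_integral φ)
  have hx' : dirac (f x) ∈ pushforward f '' {μ | 0 < ∫ x, φ x ∂μ.measure} := by
    refine ⟨dirac x, ?_, pushforward_dirac f x⟩
    have : φ x = 1 := hφ1 rfl
    simp [dirac, this]
  refine mem_of_superset (((h _ hW).preimage continuous_dirac).mem_nhds hx') ?_
  rintro y ⟨μ, hμ, hμy⟩
  by_contra hy
  have hnull : μ.measure (f ⁻¹' {y})ᶜ = 0 := by
    have h1 := congrArg (fun ν => ν.measure {y}ᶜ) hμy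
    simpa [pushforward, dirac, Measure.map_apply f.continuous.measurable] using h1
  have h0 : (fun x => φ x) =ᵐ[μ.measure] 0 := by
    have hae : ∀ᵐ x ∂μ.measure, x ∈ f ⁻¹' {y} := hnull
    filter_upwards [hae] with z hz
    exact hφ0 fun hzU => hy ⟨z, hzU, hz⟩
  have hμ' : 0 < ∫ x, φ x ∂μ.measure := hμ
  rw [integral_congr_ae h0] at hμ'
  simp at hμ'

/-- The sublinear functional on `C(X, ℝ)` whose dominated linear functionals are the lifts of
`ν` along `f`. -/
noncomputable def upperIntegral (f : C(X, Y)) (ν : RegularProbability Y) (g : C(X, ℝ)) : ℝ :=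
  ∫ y, fiberSup f g y ∂ν.measure

section Open

variable (f : C(X, Y)) (hf : Function.Surjective f) (ho : IsOpenMap f)
include hf ho

theorem integrable_fiberSup (ν : RegularProbability Y) (g : C(X, ℝ)) :
    Integrable (fiberSup f g) ν.measure :=
  ν.integrable ⟨_, continuous_fiberSup f hf ho g⟩

theorem upperIntegral_add_le (ν : RegularProbability Y) (g h : C(X, ℝ)) :
    upperIntegral f ν (g + h) ≤ upperIntegral f ν g + upperIntegral f ν h := by
  have hi := integrable_fiberSup f hf ho ν
  rw [upperIntegral, upperIntegral, upperIntegral, ← integral_add (hi g) (hi h)]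
  exact integral_mono (hi _) ((hi g).add (hi h)) (fiberSup_add_le f hf g h)

theorem upperIntegral_le_add_norm (ν : RegularProbability Y) (g h : C(X, ℝ)) :
    upperIntegral f ν g ≤ upperIntegral f ν h + ‖g - h‖ := by
  have := ν.isProbability
  have hi := integrable_fiberSup f hf ho ν
  have h1 : ∫ y, (fiberSup f h y + ‖g - h‖) ∂ν.measure = upperIntegral f ν h + ‖g - h‖ := by
    rw [integral_add (hi h) (integrable_const _)]
    simp [upperIntegral]
  rw [← h1]
  exact integral_mono (hi g) ((hi h).add (integrable_const _)) (fiberSup_le_add_norm f hf g h)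

theorem integral_le_upperIntegral (μ : RegularProbability X) (g : C(X, ℝ)) :
    ∫ x, g x ∂μ.measure ≤ upperIntegral f (pushforward f μ) g := by
  let g' : C(Y, ℝ) := ⟨_, continuous_fiberSup f hf ho g⟩
  exact (integral_mono (μ.integrable g) (μ.integrable (g'.comp f)) (le_fiberSup f g)).trans_eq
    (integral_pushforward f μ g').symm

/-- The functional is 1-Lipschitz in `g` uniformly in `ν`, so continuity in `ν` for fixed `g`
suffices. -/
theorem continuous_upperIntegral :
    Continuous fun p : RegularProbability Y × C(X, ℝ) => upperIntegral f p.1 p.2 := by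
  rw [continuous_iff_continuousAt]
  rintro ⟨ν₀, g₀⟩
  have h1 : Tendsto (fun p : RegularProbability Y × C(X, ℝ) => upperIntegral f p.1 g₀)
      (𝓝 (ν₀, g₀)) (𝓝 (upperIntegral f ν₀ g₀)) :=
    ((continuous_integral ⟨_, continuous_fiberSup f hf ho g₀⟩).comp continuous_fst).tendsto _
  have h2 : Tendsto (fun p : RegularProbability Y × C(X, ℝ) => ‖p.2 - g₀‖)
      (𝓝 (ν₀, g₀)) (𝓝 0) := by
    have : Continuous fun p : RegularProbability Y × C(X, ℝ) => ‖p.2 - g₀‖ := by fun_prop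
    simpa using this.tendsto (ν₀, g₀)
  refine tendsto_of_tendsto_of_tendsto_of_le_of_le (by simpa using h1.sub h2)
    (by simpa using h1.add h2) (fun p => ?_) fun p => ?_
  · have := upperIntegral_le_add_norm f hf ho p.1 g₀ p.2
    rw [norm_sub_rev] at this
    simpa using this
  · exact upperIntegral_le_add_norm f hf ho p.1 p.2 g₀

omit ho in
theorem upperIntegral_comp (ν : RegularProbability Y) (h : C(Y, ℝ)) :
    upperIntegral f ν (h.comp f) = ∫ y, h y ∂ν.measure := by
  simp only [upperIntegral, fiberSup_comp f hf]

omit ho in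
-- Domination at `±h ∘ f` fixes the marginal, and at `-g` with `g ≥ 0` it gives positivity; Riesz
-- then supplies the measure.
theorem exists_pushforward_eq_of_le_upperIntegral (ν : RegularProbability Y)
    (L : C(X, ℝ) →ₗ[ℝ] ℝ) (hL : ∀ g, L g ≤ upperIntegral f ν g) :
    ∃ μ, pushforward f μ = ν ∧ ∀ φ : C(X, ℝ), ∫ x, φ x ∂μ.measure = L φ := by
  have hcomp : ∀ h : C(Y, ℝ), L (h.comp f) = ∫ y, h y ∂ν.measure := by
    intro h
    have h1 := hL (h.comp f)
    have h2 := hL ((-h).comp f)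
    rw [upperIntegral_comp f hf] at h1 h2
    have h3 : (-h).comp f = -(h.comp f) := rfl
    simp only [h3, map_neg, ContinuousMap.neg_apply, integral_neg] at h2
    linarith
  have hpos : ∀ g, 0 ≤ g → 0 ≤ L g := by
    intro g hg
    have h1 := hL (-g)
    have h2 : upperIntegral f ν (-g) ≤ 0 := by
      refine integral_nonpos fun y => ?_
      refine (fiberSup_le_iff f hf _ _ _).2 fun x _ => ?_
      simpa using hg x
    rw [map_neg] at h1
    linarith
  have hone : L 1 = 1 := by
    have := ν.isProbability
    have h1 := hcomp 1
    simpa [show (1 : C(Y, ℝ)).comp f = 1 from rfl] using h1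
  obtain ⟨μ, hμ⟩ := exists_integral_eq L hpos hone
  refine ⟨μ, ext_of_integral_eq fun h => ?_, hμ⟩
  rw [integral_pushforward, ← hcomp, ← hμ]
  rfl

omit hf ho in
theorem upperIntegral_smul (ν : RegularProbability Y) (g : C(X, ℝ)) {c : ℝ} (hc : 0 ≤ c) :
    upperIntegral f ν (c • g) = c * upperIntegral f ν g := by
  simp only [upperIntegral, fiberSup_smul f g hc, integral_const_mul]

/-- Hahn–Banach: a lift of `ν` with prescribed approximate values on finitely many functions
exists as soon as no linear combination of these functions obstructs it. -/
theorem exists_pushforward_eq_of_forall_nonneg (ν : RegularProbability Y) {E : Type*}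
    [NormedAddCommGroup E] [NormedSpace ℝ E] (Φ : E →ₗ[ℝ] C(X, ℝ)) (t : E →ₗ[ℝ] ℝ) {ε : ℝ}
    (hε : 0 ≤ ε) (h : ∀ c, 0 ≤ upperIntegral f ν (Φ c) + ε * ‖c‖ - t c) :
    ∃ μ, pushforward f μ = ν ∧ ∀ c, |∫ x, Φ c x ∂μ.measure - t c| ≤ ε * ‖c‖ := by
  -- Extending `0` from the vectors `(Φ c, -c)` forces `G (Φ c, 0) = G (0, c)`: the first slot
  -- yields the lift, and the bound on the second controls its error.
  let j : E →ₗ[ℝ] C(X, ℝ) × E := Φ.prod (-LinearMap.id)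
  obtain ⟨G, hG0, hGN⟩ := exists_extension_of_le_sublinear
    (⟨LinearMap.range j, 0⟩ : (C(X, ℝ) × E) →ₗ.[ℝ] ℝ)
    (fun p => upperIntegral f ν p.1 + ε * ‖p.2‖ + t p.2)
    (fun a ha p => by
      simp only [Prod.smul_fst, Prod.smul_snd, upperIntegral_smul f ν _ ha.le, norm_smul,
        Real.norm_of_nonneg ha.le, map_smul, smul_eq_mul]
      ring)
    (fun p q => by
      have h1 := upperIntegral_add_le f hf ho ν p.1 q.1
      have h2 := mul_le_mul_of_nonneg_left (norm_add_le p.2 q.2) hε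
      simp only [Prod.fst_add, Prod.snd_add, map_add]
      linarith)
    (by
      rintro ⟨_, c, rfl⟩
      simpa [j, sub_eq_add_neg] using! h c)
  obtain ⟨μ, hμν, hμ⟩ := exists_pushforward_eq_of_le_upperIntegral f hf ν
    (G ∘ₗ LinearMap.inl ℝ _ _) (fun g => by simpa using hGN (g, 0))
  have key : ∀ c, ∫ x, Φ c x ∂μ.measure - t c ≤ ε * ‖c‖ := by
    intro c
    have h0 : upperIntegral f ν 0 = 0 := by simpa using upperIntegral_smul f ν 0 le_rfl
    have h1 : G (j c) = 0 := hG0 ⟨j c, c, rfl⟩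
    have h2 : G (Φ c, 0) = G (0, c) := by
      have h3 : j c = (Φ c, 0) - (0, c) := by simp [j]
      rw [h3, map_sub] at h1
      linarith
    have h3 := hGN (0, c)
    simp only [h0, zero_add] at h3
    rw [hμ, LinearMap.comp_apply, LinearMap.inl_apply, h2]
    linarith
  refine ⟨μ, hμν, fun c => abs_le.2 ⟨?_, key c⟩⟩
  have h1 := key (-c)
  simp only [map_neg, ContinuousMap.neg_apply, integral_neg, norm_neg] at h1
  linarith

theorem isOpenMap_pushforward : IsOpenMap (pushforward f) := by
  rw [isOpenMap_iff_nhds_le]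
  intro μ s hs
  obtain ⟨I, ε, hε, hI⟩ := exists_finset_of_mem_nhds (mem_map.1 hs)
  let Φ : (I → ℝ) →L[ℝ] C(X, ℝ) :=
    LinearMap.toContinuousLinearMap (Fintype.linearCombination ℝ (fun φ : I => (φ : C(X, ℝ))))
  let t : (I → ℝ) →L[ℝ] ℝ := LinearMap.toContinuousLinearMap
    { toFun := fun c => ∫ x, Φ c x ∂μ.measure
      map_add' := fun c d => by
        simp only [map_add, ContinuousMap.add_apply]
        exact integral_add (μ.integrable _) (μ.integrable _)
      map_smul' := fun a c => by
        simp only [map_smul, ContinuousMap.smul_apply, RingHom.id_apply]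
        exact integral_smul _ _ }
  have hsphere : ∀ᶠ ν in 𝓝 (pushforward f μ), ∀ c ∈ Metric.sphere (0 : I → ℝ) 1,
      0 < upperIntegral f ν (Φ c) + ε - t c := by
    refine (isCompact_sphere _ _).eventually_forall_of_forall_eventually fun c _ => ?_
    have hcont : Continuous fun p : RegularProbability Y × (I → ℝ) =>
        upperIntegral f p.1 (Φ p.2) + ε - t p.2 := by
      have := (continuous_upperIntegral f hf ho).comp
        (continuous_fst.prodMk (Φ.continuous.comp continuous_snd) :
          Continuous fun p : RegularProbability Y × (I → ℝ) => (p.1, Φ p.2))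
      exact (this.add continuous_const).sub (t.continuous.comp continuous_snd)
    refine hcont.continuousAt.eventually (lt_mem_nhds ?_)
    have h1 : t c ≤ upperIntegral f (pushforward f μ) (Φ c) :=
      integral_le_upperIntegral f hf ho μ (Φ c)
    dsimp only
    linarith
  filter_upwards [hsphere] with ν hν
  obtain ⟨μ', rfl, hμ'⟩ := exists_pushforward_eq_of_forall_nonneg f hf ho ν Φ.toLinearMap
    -- Positive homogeneity carries the bound from the unit sphere to every `c`.
    t.toLinearMap hε.le fun c => by
      rcases eq_or_ne c 0 with rfl | hc
      · have h0 : upperIntegral f ν 0 = 0 := by simpa using upperIntegral_smul f ν 0 le_rfl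
        simp [h0]
      · have hc' : 0 < ‖c‖ := norm_pos_iff.2 hc
        have h1 := hν (‖c‖⁻¹ • c) (by simp [norm_smul, hc'.ne'])
        rw [map_smul, map_smul, upperIntegral_smul f ν _ (inv_nonneg.2 hc'.le)] at h1
        have h2 := mul_pos hc' h1
        have h3 : ‖c‖ * (‖c‖⁻¹ * upperIntegral f ν (Φ c) + ε - ‖c‖⁻¹ • t c) =
            upperIntegral f ν (Φ c) + ε * ‖c‖ - t c := by
          simp only [smul_eq_mul]
          field_simp
        exact (h3 ▸ h2).le
  refine hI μ' fun φ hφ => ?_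
  classical
  have h1 := hμ' (Pi.single ⟨φ, hφ⟩ 1)
  have h2 : Φ (Pi.single ⟨φ, hφ⟩ 1) = φ := by
    simp [Φ, Fintype.linearCombination_apply_single]
  have h3 : t (Pi.single ⟨φ, hφ⟩ 1) = ∫ x, φ x ∂μ.measure := by
    change ∫ x, Φ (Pi.single ⟨φ, hφ⟩ 1) x ∂μ.measure = _
    rw [h2]
  -- Basis vectors have norm 1, so the error for each `φ` is at most `ε`.
  have h4 : ‖(Pi.single ⟨φ, hφ⟩ 1 : I → ℝ)‖ = 1 := by
    rw [Pi.norm_single, norm_one]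
  simpa only [ContinuousLinearMap.coe_coe, h2, h3, h4, mul_one] using h1

end Open

end RegularProbability

end Meas

end OpenMaps

theorem theorem3 {X : Type*} {Y : Type*}
    [TopologicalSpace X] [CompactSpace X] [T2Space X] [MeasurableSpace X] [BorelSpace X]
    [TopologicalSpace Y] [CompactSpace Y] [T2Space Y] [MeasurableSpace Y] [BorelSpace Y]
    (f : C(X, Y)) (hf : Function.Surjective f) :
    (IsOpenMap f ↔ IsOpenMap (OpenMaps.quasifactor f)) ∧
      (IsOpenMap f ↔ IsOpenMap (OpenMaps.pushforward f)) :=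
  ⟨⟨OpenMaps.isOpenMap_quasifactor f, OpenMaps.isOpenMap_of_quasifactor f⟩,
    ⟨OpenMaps.RegularProbability.isOpenMap_pushforward f hf,
      OpenMaps.RegularProbability.isOpenMap_of_pushforward f⟩⟩
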